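/- Permutations $\pi=a_1a_2\cdots a_m$ of $[m]=\{1,\dots,m\}$ are written in one-line notation; an index $i\in[m-1]$ is a descent of $\pi$ if $a_i>a_{i+1}$, and the descent is called odd or even according to the parity of $i$. Let $A_{m,k}$ (Eulerian number) be the number of permutations of $[m]$ with exactly $k$ descents, let $a_{m,k}$ be the number of permutations of $[m]$ with exactly $k$ even descents and no odd descents, and let $E_m$ (Euler number) be the number of alternating permutations of $[m]$, i.e. those with $a_1>a_2<a_3>\cdots$. For all integers $n\ge k\ge 0$, $$A_{2n+1,k}=\sum_{i=0}^{\lfloor k/2\rfloor}\binom{n-k+2i}{i}2^{k-2i}a_{2n+1,k-2i},\qquad A_{2n+2,k}=\sum_{\substack{i,j\ge0\\ 2i+j=k\text{ or }2i+j=k-1}}\binom{n-j}{i}2^{j}a_{2n+2,j},$$ and, inversely, $$a_{2n+1,k}=\frac1{2^k}\sum_{i=0}^{\lfloor k/2\rfloor}(-1)^i\,\frac{n-k+2i}{n-k+i}\binom{n-k+i}{i}A_{2n+1,k-2i},$$ $$a_{2n+2,k}=\frac1{2^k}\sum_{\substack{i,j,r\ge0\\ 2i+j+r=k}}(-1)^{r+i}\,\frac{n-k+2i}{n-k+i}\binom{n-k+i}{i}A_{2n+2,j},$$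 where the quotient $\frac{n-k+2i}{n-k+i}$ is read as $1$ in the indeterminate case $k=n$, $i=0$. In particular, for every integer $n\ge0$, $$E_{2n+1}=a_{2n+1,n}=\frac1{2^n}\Big(-A_{2n+1,n}+2\sum_{i=0}^{\lfloor n/2\rfloor}(-1)^iA_{2n+1,n-2i}\Big),$$ $$E_{2n+2}=a_{2n+2,n}=\frac1{2^n}\Big(-\sum_{j=0}^{n}(-1)^{n-j}A_{2n+2,j}+2\sum_{\substack{i,j\ge0\\ 2i+j\le n}}(-1)^{n-i-j}A_{2n+2,j}\Big).$$ -/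

import Mathlib

namespace EulerianDescents

/-- A permutation of `[n]` is a `σ : Equiv.Perm (Fin n)`, with one-line notation `a₁ a₂ … aₙ` where
`a_i` is the value of `σ` at the `i`-th (counted from `1`) element of `Fin n`, that is at `⟨i - 1, _⟩`.
The index `i` with `1 ≤ i ≤ n - 1` is a descent if `a_i > a_{i+1}`. -/
def IsDescent {n : ℕ} (σ : Equiv.Perm (Fin n)) (i : ℕ) : Prop :=
  ∃ h : 1 ≤ i ∧ i < n, σ ⟨i, h.2⟩ < σ ⟨i - 1, lt_of_le_of_lt (Nat.sub_le i 1) h.2⟩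

instance {n : ℕ} (σ : Equiv.Perm (Fin n)) : DecidablePred (IsDescent σ) :=
  fun i => by unfold IsDescent; infer_instance

/-- The number of descents. -/
def des {n : ℕ} (σ : Equiv.Perm (Fin n)) : ℕ :=
  ((Finset.range n).filter fun i => IsDescent σ i).card

/-- The number of descents at odd positions. -/
def odes {n : ℕ} (σ : Equiv.Perm (Fin n)) : ℕ :=
  ((Finset.range n).filter fun i => IsDescent σ i ∧ Odd i).card

/-- The number of descents at even positions. -/
def edes {n : ℕ} (σ : Equiv.Perm (Fin n)) : ℕ :=
  ((Finset.range n).filter fun i => IsDescent σ i ∧ Even i).card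

/-- The Eulerian number `A_{n,k}`. -/
def eulerian (n k : ℕ) : ℕ :=
  (Finset.univ.filter fun σ : Equiv.Perm (Fin n) => des σ = k).card

/-- `a_{n,k}`: the number of permutations with `k` even descents and no odd descents. -/
def evenDescentCount (n k : ℕ) : ℕ :=
  (Finset.univ.filter fun σ : Equiv.Perm (Fin n) => edes σ = k ∧ odes σ = 0).card

/-- `a₁ > a₂ < a₃ > ⋯`; since the values are distinct, `a_i < a_{i+1}` means that `i` is not a
descent. -/
def IsAlternating {n : ℕ} (σ : Equiv.Perm (Fin n)) : Prop :=
  ∀ i ∈ Finset.Ico 1 n, IsDescent σ i ↔ Odd i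

instance {n : ℕ} : DecidablePred (IsAlternating (n := n)) :=
  fun σ => by unfold IsAlternating; infer_instance

/-- The Euler number `E_n`: the number of alternating permutations of `[n]`. -/
def eulerNumber (n : ℕ) : ℕ :=
  (Finset.univ.filter fun σ : Equiv.Perm (Fin n) => IsAlternating σ).card

/-- The coefficient `(m + 2i) / (m + i) * binom (m + i) i`, where the quotient is read as `1` in the
indeterminate case `m = i = 0`. -/
def invCoeff (m i : ℕ) : ℚ :=
  (if m + i = 0 then 1 else ((m : ℚ) + 2 * i) / ((m : ℚ) + i)) * ((m + i).choose i : ℚ)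

end EulerianDescents

open EulerianDescents

/-! ### Words weighted by descents, and the recursion at the largest letter. -/

namespace EulerianDescents

open Finset

/-! Let F_N(p, q) be the sum of p^odes q^edes over permutations of [N] (`oddEvenSum`). The key fact
is that F_{2n+1} and F_{2n+2} / (1 + p) are homogeneous polynomials of degree n in p + q and 1 + pq
(`isHomogSymm_oddEvenSum_and_reducedEvenSum`). It follows by induction from the recursion obtained
by cutting a permutation at its largest letter (`oddEvenSum_succ`), together with the symmetry of
F_{2n+1} under reverse-complement.

Such a polynomial is determined by its values at p = 0, q = t, where p + q = t and 1 + pq = 1: its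
coefficients are the numbers a_{N,j}. At p = q = t it becomes the sum of 2^j a_{N,j} t^j (1 +
t^2)^(n-j), while F_N(t, t) is the Eulerian polynomial. Comparing coefficients gives the direct
formulas; for even N the extra factor 1 + t turns Eulerian numbers into their alternating partial
sums.

The inverse formulas are a binomial inversion (`eq_sum_invCoeff_mul`), resting on the generating
function (1 - X) / (1 + X)^(m+1) of the signed coefficients. The Euler numbers are the case k = n,
where every even position must be a descent. -/

/-- The weight of a word: a factor `p` for each descent at an odd position, and a factor `q` for
each descent at an even position. -/
def descentWeight : List ℕ → ℚ → ℚ → ℚ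
  | [], _, _ => 1
  | [_], _, _ => 1
  | a :: b :: l, p, q => (if b < a then p else 1) * descentWeight (b :: l) q p

lemma descentWeight_cons_of_forall_lt {M : ℕ} {l : List ℕ} (h : ∀ x ∈ l, x < M) (p q : ℚ) :
    descentWeight (M :: l) p q = (if l = [] then 1 else p) * descentWeight l q p := by
  cases l with
  | nil => simp [descentWeight]
  | cons b l => simp [descentWeight, h b (by simp)]

/-- No descent occurs at the junction, since `M` exceeds the letter before it. The parity of
`l.length` decides whether `M` stands at an odd or an even position, hence the order of `p` and `q`
in the second factor. -/
lemma descentWeight_append_cons {M : ℕ} {l : List ℕ} (h : ∀ x ∈ l, x < M) (l' : List ℕ) (p q : ℚ) :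
    descentWeight (l ++ M :: l') p q = descentWeight l p q *
      (if Even l.length then descentWeight (M :: l') p q else descentWeight (M :: l') q p) := by
  induction l generalizing p q with
  | nil => simp [descentWeight]
  | cons a l ih =>
    have ih' := ih (fun x hx => h x (by simp [hx])) q p
    cases l with
    | nil =>
      have : ¬ M < a := (h a (by simp)).le.not_gt
      simp [descentWeight, this]
    | cons b l =>
      simp only [List.cons_append, descentWeight] at ih' ⊢
      rw [ih', ← mul_assoc]
      congr 1
      simp only [List.length_cons, Nat.even_add_one]
      split_ifs <;> rfl

/-- The finite set of the words in which each element of `S` occurs once. -/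
def orderings (S : Finset ℕ) : Finset (List ℕ) :=
  ⟨S.val.lists, Multiset.lists_nodup_finset S⟩

lemma mem_orderings {S : Finset ℕ} {l : List ℕ} : l ∈ orderings S ↔ S.val = (l : Multiset ℕ) := by
  simp [orderings, Multiset.mem_lists_iff]

lemma mem_iff_of_mem_orderings {S : Finset ℕ} {l : List ℕ} (h : l ∈ orderings S) (x : ℕ) :
    x ∈ l ↔ x ∈ S := by
  rw [← Multiset.mem_coe, ← mem_orderings.1 h, Finset.mem_val]

lemma length_of_mem_orderings {S : Finset ℕ} {l : List ℕ} (h : l ∈ orderings S) :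
    l.length = #S := by
  rw [← Multiset.coe_card, ← mem_orderings.1 h, Finset.card_val]

lemma nodup_of_mem_orderings {S : Finset ℕ} {l : List ℕ} (h : l ∈ orderings S) : l.Nodup := by
  rw [← Multiset.coe_nodup, ← mem_orderings.1 h]
  exact S.nodup

lemma mem_orderings_iff {S : Finset ℕ} {l : List ℕ} :
    l ∈ orderings S ↔ l.Nodup ∧ ∀ x, x ∈ l ↔ x ∈ S := by
  refine ⟨fun h => ⟨nodup_of_mem_orderings h, mem_iff_of_mem_orderings h⟩, fun ⟨h, h'⟩ => ?_⟩
  rw [mem_orderings, Multiset.Nodup.ext S.nodup (Multiset.coe_nodup.2 h)]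
  intro x
  simp [h']

/-- The generating function of the orderings of `S` by odd and even descents. -/
def weightSum (S : Finset ℕ) (p q : ℚ) : ℚ := ∑ l ∈ orderings S, descentWeight l p q

/-- Cut each word at `M`, with `U` the set of letters on the left. The position of `M` is `#U + 1`,
and it is a descent exactly when some letter follows, that is, when `#U ≠ #T`. -/
lemma weightSum_insert {M : ℕ} {T : Finset ℕ} (hT : ∀ x ∈ T, x < M) (p q : ℚ) :
    weightSum (insert M T) p q = ∑ U ∈ T.powerset, weightSum U p q *
      (if Even #U then (if #U = #T then 1 else p) * weightSum (T \ U) q p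
        else (if #U = #T then 1 else q) * weightSum (T \ U) p q) := by
  have hM : M ∉ T := fun h => (hT M h).ne rfl
  have key : weightSum (insert M T) p q =
      ∑ x ∈ T.powerset.sigma (fun U => orderings U ×ˢ orderings (T \ U)),
        descentWeight (x.2.1 ++ M :: x.2.2) p q := by
    symm
    refine Finset.sum_nbij (fun x => x.2.1 ++ M :: x.2.2) ?_ ?_ ?_ (fun _ _ => rfl)
    · rintro ⟨U, l, l'⟩ hx
      simp only [mem_sigma, mem_powerset, mem_product] at hx
      obtain ⟨hU, hl, hl'⟩ := hx
      rw [mem_orderings_iff] at hl hl' ⊢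
      refine ⟨?_, fun x => ?_⟩
      · rw [List.nodup_append, List.nodup_cons]
        refine ⟨hl.1, ⟨?_, hl'.1⟩, ?_⟩
        · rw [hl'.2]; simp [hM]
        · intro a ha b hb
          rw [hl.2] at ha
          rw [List.mem_cons, hl'.2] at hb
          rintro rfl
          rcases hb with rfl | hb
          · exact hM (hU ha)
          · simp [ha] at hb
      · have := @hU x
        simp only [List.mem_append, List.mem_cons, hl.2, hl'.2, mem_sdiff, mem_insert]
        tauto
    · rintro ⟨U, l, l'⟩ hx ⟨V, k, k'⟩ hy hxy
      simp only [coe_sigma, Set.mem_sigma_iff, mem_coe, mem_powerset, mem_product] at hx hy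
      obtain ⟨hU, hl, hl'⟩ := hx
      obtain ⟨hV, hk, hk'⟩ := hy
      have h1 : M ∉ l := by rw [mem_iff_of_mem_orderings hl]; exact fun h => hM (hU h)
      have h2 : M ∉ l' := by rw [mem_iff_of_mem_orderings hl']; simp [hM]
      have h3 : M ∉ k := by rw [mem_iff_of_mem_orderings hk]; exact fun h => hM (hV h)
      have := (List.append_cons_inj_of_notMem h1 h2).1 hxy
      obtain ⟨rfl, -, rfl⟩ := this
      have : U = V := by
        ext x; rw [← mem_iff_of_mem_orderings hl, mem_iff_of_mem_orderings hk]
      subst this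
      rfl
    · intro l hl
      rw [mem_coe, mem_orderings_iff] at hl
      obtain ⟨l₁, l₂, rfl⟩ := List.append_of_mem ((hl.2 M).2 (mem_insert_self _ _))
      obtain ⟨hnd, hmem⟩ := hl
      rw [List.nodup_append, List.nodup_cons] at hnd
      obtain ⟨h1, ⟨h2, h3⟩, h4⟩ := hnd
      simp only [List.mem_append, List.mem_cons, mem_insert] at hmem
      have h5 : ∀ x ∈ l₁, x ≠ M := fun x hx => h4 x hx M (by simp)
      have h6 : ∀ x ∈ l₁, x ∉ l₂ := fun x hx hx' => h4 x hx x (by simp [hx']) rfl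
      refine ⟨⟨l₁.toFinset, l₁, l₂⟩, ?_, rfl⟩
      simp only [coe_sigma, Set.mem_sigma_iff, mem_coe, mem_powerset, mem_product,
        mem_orderings_iff, mem_sdiff, List.mem_toFinset, implies_true, and_true]
      refine ⟨fun x hx => ?_, h1, h3, fun x => ?_⟩
      · rw [List.mem_toFinset] at hx
        exact ((hmem x).1 (Or.inl hx)).resolve_left (h5 x hx)
      · have := hmem x
        have := h6 x
        have := h5 x
        have : x ∈ T → x ≠ M := fun h => (hT x h).ne
        have : x ∈ l₂ → x ≠ M := by rintro h rfl; exact h2 h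
        tauto
  rw [key, Finset.sum_sigma]
  refine sum_congr rfl fun U hU => ?_
  rw [mem_powerset] at hU
  rw [sum_product, weightSum, sum_mul]
  refine sum_congr rfl fun l hl => ?_
  have hlM : ∀ x ∈ l, x < M := fun x hx => hT x (hU ((mem_iff_of_mem_orderings hl x).1 hx))
  simp only [descentWeight_append_cons hlM, ← mul_sum, length_of_mem_orderings hl]
  congr 1
  have hnil : ∀ l' ∈ orderings (T \ U), l' = [] ↔ #U = #T := by
    intro l' hl'
    rw [← List.length_eq_zero_iff, length_of_mem_orderings hl', card_sdiff_of_subset hU]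
    have := card_le_card hU
    omega
  have hlt : ∀ l' ∈ orderings (T \ U), ∀ x ∈ l', x < M := fun l' hl' x hx =>
    hT x (mem_sdiff.1 ((mem_iff_of_mem_orderings hl' x).1 hx)).1
  split_ifs with h1 h2 h2 <;> rw [weightSum, mul_sum] <;> refine sum_congr rfl fun l' hl' => ?_ <;>
    rw [descentWeight_cons_of_forall_lt (hlt l' hl')] <;> simp [hnil l' hl', h2]

/-- Conditional form for the induction below: `h` lets each subset be replaced by an initial
segment, after which the sum over `U` depends on `#U` only. -/
lemma weightSum_insert_of_forall_card_le {M : ℕ} {T : Finset ℕ} (hT : ∀ x ∈ T, x < M)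
    (h : ∀ U : Finset ℕ, #U ≤ #T → ∀ p q, weightSum U p q = weightSum (range #U) p q) (p q : ℚ) :
    weightSum (insert M T) p q =
      ∑ m ∈ range (#T + 1), (#T).choose m * (weightSum (range m) p q *
        (if Even m then (if m = #T then 1 else p) * weightSum (range (#T - m)) q p
          else (if m = #T then 1 else q) * weightSum (range (#T - m)) p q)) := by
  have := sum_powerset_apply_card (fun m => weightSum (range m) p q *
      (if Even m then (if m = #T then 1 else p) * weightSum (range (#T - m)) q p
        else (if m = #T then 1 else q) * weightSum (range (#T - m)) p q)) (x := T)
  simp only [nsmul_eq_mul] at this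
  rw [weightSum_insert hT, ← this]
  refine sum_congr rfl fun U hU => ?_
  rw [mem_powerset] at hU
  rw [h U (card_le_card hU), h (T \ U) (card_le_card sdiff_subset), h (T \ U)
    (card_le_card sdiff_subset), card_sdiff_of_subset hU]

/-- The recursion at the maximum sees only cardinalities, so induction on the size applies without
relabelling words. The weights are quantified inside the induction because the recursion swaps them.
-/
lemma weightSum_eq_range_card (S : Finset ℕ) (p q : ℚ) :
    weightSum S p q = weightSum (range #S) p q := by
  suffices ∀ N, ∀ U : Finset ℕ, #U ≤ N → ∀ p q, weightSum U p q = weightSum (range #U) p q from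
    this _ S le_rfl p q
  intro N
  induction N with
  | zero =>
    intro U hU p q
    obtain rfl : U = ∅ := by simpa using hU
    simp
  | succ N ih =>
    intro U hU p q
    rcases hU.lt_or_eq with hU | hU
    · exact ih U (by omega) p q
    · have hne : U.Nonempty := card_pos.1 (by omega)
      have hc : #(U.erase (U.max' hne)) = N := by
        rw [card_erase_of_mem (U.max'_mem hne)]; omega
      have h1 := weightSum_insert_of_forall_card_le
        (fun x hx => U.lt_max'_of_mem_erase_max' hne hx) (by rwa [hc]) p q
      have h2 := weightSum_insert_of_forall_card_le (M := N) (T := range N) (by simp)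
        (by rwa [card_range]) p q
      rw [insert_erase (U.max'_mem hne), hc] at h1
      rw [card_range, ← range_add_one] at h2
      rw [h1, hU, h2]

lemma weightSum_range_succ (N : ℕ) (p q : ℚ) :
    weightSum (range (N + 1)) p q = ∑ m ∈ range (N + 1), N.choose m * (weightSum (range m) p q *
      (if Even m then (if m = N then 1 else p) * weightSum (range (N - m)) q p
        else (if m = N then 1 else q) * weightSum (range (N - m)) p q)) := by
  have := weightSum_insert_of_forall_card_le (M := N) (T := range N) (by simp)
    (fun U _ => weightSum_eq_range_card U) p q
  rwa [card_range, ← range_add_one] at this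

end EulerianDescents

/-! ### From words to permutations, and the reverse-complement symmetry. -/

namespace EulerianDescents

open Finset

lemma descentWeight_eq_prod (l : List ℕ) (p q : ℚ) :
    descentWeight l p q = ∏ i ∈ range (l.length - 1),
      if l.getD (i + 1) 0 < l.getD i 0 then (if Even i then p else q) else 1 := by
  induction l generalizing p q with
  | nil => simp [descentWeight]
  | cons a l ih =>
    cases l with
    | nil => simp [descentWeight]
    | cons b l =>
      have := ih q p
      simp only [List.length_cons, Nat.add_sub_cancel] at this ⊢
      rw [prod_range_succ', descentWeight, this, mul_comm]
      congr 1
      · refine prod_congr rfl fun i _ => ?_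
        simp only [List.getD_cons_succ, Nat.even_add_one]
        split_ifs <;> rfl

/-- The joint generating function of the numbers of odd and even descents. -/
def oddEvenSum (N : ℕ) (p q : ℚ) : ℚ :=
  ∑ σ : Equiv.Perm (Fin N), p ^ odes σ * q ^ edes σ

lemma pow_odes_mul_pow_edes {N : ℕ} (σ : Equiv.Perm (Fin N)) (p q : ℚ) :
    p ^ odes σ * q ^ edes σ =
      ∏ i ∈ range N, if IsDescent σ i then (if Odd i then p else q) else 1 := by
  rw [odes, edes, ← prod_const, ← prod_const, prod_filter, prod_filter, ← prod_mul_distrib]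
  refine prod_congr rfl fun i _ => ?_
  simp only [← Nat.not_even_iff_odd]
  by_cases h1 : IsDescent σ i <;> by_cases h2 : Even i <;> simp [h1, h2]

lemma descentWeight_ofFn {N : ℕ} (σ : Equiv.Perm (Fin N)) (p q : ℚ) :
    descentWeight (List.ofFn fun i => (σ i : ℕ)) p q = p ^ odes σ * q ^ edes σ := by
  rw [descentWeight_eq_prod, pow_odes_mul_pow_edes, List.length_ofFn]
  cases N with
  | zero => simp
  | succ N =>
    -- List indices start at 0 and positions at 1: index `i` is position `i + 1`, so the parities
    -- are opposite and the factor at 0 is dropped.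
    have h0 : ¬ IsDescent σ 0 := by rintro ⟨⟨h, _⟩, _⟩; omega
    rw [prod_range_succ', if_neg h0, mul_one, Nat.add_sub_cancel]
    refine prod_congr rfl fun i hi => ?_
    rw [mem_range] at hi
    have h1 : (List.ofFn fun i => (σ i : ℕ)).getD (i + 1) 0 = σ ⟨i + 1, by omega⟩ := by
      rw [List.getD_eq_getElem _ _ (by simpa using hi), List.getElem_ofFn]
    have h2 : (List.ofFn fun i => (σ i : ℕ)).getD i 0 = σ ⟨i, by omega⟩ := by
      rw [List.getD_eq_getElem _ _ (by rw [List.length_ofFn]; omega), List.getElem_ofFn]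
    have h3 : IsDescent σ (i + 1) ↔ (σ ⟨i + 1, by omega⟩ : ℕ) < σ ⟨i, by omega⟩ := by
      refine ⟨fun ⟨_, h⟩ => h, fun h => ⟨⟨by omega, by omega⟩, h⟩⟩
    have h4 : Odd (i + 1) ↔ Even i := by
      rw [← Nat.not_even_iff_odd, Nat.even_add_one, not_not]
    simp only [h1, h2, h3, h4]

lemma oddEvenSum_eq_weightSum (N : ℕ) (p q : ℚ) :
    oddEvenSum N p q = weightSum (range N) p q := by
  refine Finset.sum_nbij (fun σ => List.ofFn fun i => (σ i : ℕ)) ?_ ?_ ?_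
    (fun σ _ => (descentWeight_ofFn σ p q).symm)
  · intro σ _
    rw [mem_orderings_iff]
    refine ⟨List.nodup_ofFn.2 (Fin.val_injective.comp σ.injective), fun x => ?_⟩
    rw [List.mem_ofFn, mem_range]
    constructor
    · rintro ⟨i, rfl⟩; exact (σ i).2
    · intro h; exact ⟨σ.symm ⟨x, h⟩, by simp⟩
  · intro σ _ τ _ h
    ext i
    exact congrFun (List.ofFn_injective h) i
  · intro l hl
    rw [mem_coe] at hl
    have hlen : l.length = N := by rw [length_of_mem_orderings hl, card_range]
    have hlt : ∀ i : Fin N, l.get (i.cast hlen.symm) < N := fun i =>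
      mem_range.1 ((mem_iff_of_mem_orderings hl _).1 (l.get_mem _))
    have hinj : Function.Injective fun i : Fin N => (⟨l.get (i.cast hlen.symm), hlt i⟩ : Fin N) := by
      intro i j h
      have := List.nodup_iff_injective_get.1 (nodup_of_mem_orderings hl) (Fin.mk.inj h)
      simpa [Fin.ext_iff] using this
    refine ⟨Equiv.ofBijective _ (Finite.injective_iff_bijective.1 hinj), by simp, ?_⟩
    refine List.ext_getElem (by simp [hlen]) fun i h1 h2 => ?_
    simp

lemma oddEvenSum_succ (N : ℕ) (p q : ℚ) :
    oddEvenSum (N + 1) p q = ∑ m ∈ range (N + 1), N.choose m * (oddEvenSum m p q *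
      (if Even m then (if m = N then 1 else p) * oddEvenSum (N - m) q p
        else (if m = N then 1 else q) * oddEvenSum (N - m) p q)) := by
  simp only [oddEvenSum_eq_weightSum]
  exact weightSum_range_succ N p q

lemma isDescent_rev_mul_mul_rev {N : ℕ} (σ : Equiv.Perm (Fin N)) {i : ℕ} (hi : i ≤ N) :
    IsDescent (Fin.revPerm * σ * Fin.revPerm) (N - i) ↔ IsDescent σ i := by
  simp only [IsDescent, Equiv.Perm.mul_apply, Fin.revPerm_apply, Fin.rev_lt_rev]
  refine ⟨fun ⟨⟨h1, h2⟩, h⟩ => ⟨⟨by omega, by omega⟩, ?_⟩,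
    fun ⟨⟨h1, h2⟩, h⟩ => ⟨⟨by omega, by omega⟩, ?_⟩⟩ <;>
  · convert h using 2 <;> ext <;> simp only [Fin.val_rev] <;> omega

/-- Reverse-complement moves a descent from `i` to `2 * n + 1 - i`, which has the other parity. -/
lemma oddEvenSum_symm_of_odd (n : ℕ) (p q : ℚ) :
    oddEvenSum (2 * n + 1) p q = oddEvenSum (2 * n + 1) q p := by
  rw [oddEvenSum, oddEvenSum]
  refine Fintype.sum_equiv ((Equiv.mulLeft Fin.revPerm).trans (Equiv.mulRight Fin.revPerm)) _ _
    fun σ => ?_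
  have key : ∀ P Q : ℕ → Prop, [DecidablePred P] → [DecidablePred Q] →
      (∀ i ≤ 2 * n + 1, P i ↔ Q (2 * n + 1 - i)) →
      #{i ∈ range (2 * n + 1) | IsDescent σ i ∧ P i} =
        #{i ∈ range (2 * n + 1) | IsDescent (Fin.revPerm * σ * Fin.revPerm) i ∧ Q i} := by
    intro P Q _ _ h
    refine card_nbij' (fun i => 2 * n + 1 - i) (fun i => 2 * n + 1 - i) ?_ ?_ ?_ ?_
    · intro i hi
      simp only [mem_coe, mem_filter, mem_range] at hi ⊢
      have : 1 ≤ i := hi.2.1.1.1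
      refine ⟨by omega, (isDescent_rev_mul_mul_rev σ hi.1.le).2 hi.2.1, (h i hi.1.le).1 hi.2.2⟩
    · intro i hi
      simp only [mem_coe, mem_filter, mem_range] at hi ⊢
      have : 1 ≤ i := hi.2.1.1.1
      have e : 2 * n + 1 - (2 * n + 1 - i) = i := by omega
      refine ⟨by omega, (isDescent_rev_mul_mul_rev σ (by omega)).1 (by rw [e]; exact hi.2.1),
        (h _ (by omega)).2 (by rw [e]; exact hi.2.2)⟩
    · intro i hi
      simp only [mem_coe, mem_filter, mem_range] at hi
      show 2 * n + 1 - (2 * n + 1 - i) = i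
      omega
    · intro i hi
      simp only [mem_coe, mem_filter, mem_range] at hi
      show 2 * n + 1 - (2 * n + 1 - i) = i
      omega
  have h1 : odes σ = edes (Fin.revPerm * σ * Fin.revPerm) := by
    refine key _ _ fun i hi => ?_
    rw [Nat.odd_iff, Nat.even_iff]; omega
  have h2 : edes σ = odes (Fin.revPerm * σ * Fin.revPerm) := by
    refine key _ _ fun i hi => ?_
    rw [Nat.odd_iff, Nat.even_iff]; omega
  simp only [Equiv.trans_apply, Equiv.coe_mulLeft, Equiv.coe_mulRight]
  rw [h1, h2, mul_comm]

end EulerianDescents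

/-! ### Homogeneity in p + q and 1 + pq. -/

namespace EulerianDescents

open Finset Polynomial

/-- For `p, q ≥ 0`, the function `f` is a homogeneous polynomial of degree `n` in `p + q` and
`1 + p * q`. The polynomial `g` is its dehomogenization. -/
def IsHomogSymm (n : ℕ) (f : ℚ → ℚ → ℚ) : Prop :=
  ∃ g : ℚ[X], g.natDegree ≤ n ∧
    ∀ p q, 0 ≤ p → 0 ≤ q → f p q = (1 + p * q) ^ n * g.eval ((p + q) / (1 + p * q))

namespace IsHomogSymm

variable {n m : ℕ} {f g : ℚ → ℚ → ℚ}

lemma symm (hf : IsHomogSymm n f) {p q : ℚ} (hp : 0 ≤ p) (hq : 0 ≤ q) : f p q = f q p := by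
  obtain ⟨a, _, ha⟩ := hf
  rw [ha p q hp hq, ha q p hq hp, mul_comm p q, add_comm p q]

lemma congr (hf : IsHomogSymm n f) (h : ∀ p q, 0 ≤ p → 0 ≤ q → g p q = f p q) :
    IsHomogSymm n g := by
  obtain ⟨a, ha, ha'⟩ := hf
  exact ⟨a, ha, fun p q hp hq => by rw [h p q hp hq, ha' p q hp hq]⟩

lemma add (hf : IsHomogSymm n f) (hg : IsHomogSymm n g) :
    IsHomogSymm n fun p q => f p q + g p q := by
  obtain ⟨a, ha, ha'⟩ := hf
  obtain ⟨b, hb, hb'⟩ := hg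
  refine ⟨a + b, natDegree_add_le_of_degree_le ha hb, fun p q hp hq => ?_⟩
  simp only [ha' p q hp hq, hb' p q hp hq, eval_add]
  ring

lemma mul (hf : IsHomogSymm n f) (hg : IsHomogSymm m g) :
    IsHomogSymm (n + m) fun p q => f p q * g p q := by
  obtain ⟨a, ha, ha'⟩ := hf
  obtain ⟨b, hb, hb'⟩ := hg
  refine ⟨a * b, natDegree_mul_le_of_le ha hb, fun p q hp hq => ?_⟩
  simp only [ha' p q hp hq, hb' p q hp hq, eval_mul]
  ring

lemma const (c : ℚ) : IsHomogSymm 0 fun _ _ => c :=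
  ⟨C c, by simp, by simp⟩

lemma const_mul (c : ℚ) (hf : IsHomogSymm n f) : IsHomogSymm n fun p q => c * f p q := by
  simpa using (const c).mul hf

lemma sum {ι : Type*} (s : Finset ι) {f : ι → ℚ → ℚ → ℚ} (hf : ∀ i ∈ s, IsHomogSymm n (f i)) :
    IsHomogSymm n fun p q => ∑ i ∈ s, f i p q := by
  classical
  induction s using Finset.induction_on with
  | empty => exact ⟨0, by simp, by simp⟩
  | insert i s hi ih =>
    simp only [sum_insert hi]
    exact (hf i (by simp)).add (ih fun j hj => hf j (by simp [hj]))

lemma one_add_mul : IsHomogSymm 1 fun p q => 1 + p * q :=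
  ⟨1, by simp, by simp⟩

lemma add_self : IsHomogSymm 1 fun p q => p + q := by
  refine ⟨X, by simp, fun p q hp hq => ?_⟩
  have : (1 + p * q) ≠ 0 := by positivity
  rw [eval_X, pow_one, mul_div_cancel₀ _ this]

end IsHomogSymm

lemma sum_range_two_mul_add_two {M : Type*} [AddCommMonoid M] (f : ℕ → M) (n : ℕ) :
    ∑ m ∈ range (2 * n + 2), f m =
      f 0 + f (2 * n + 1) + (∑ a ∈ range n, f (2 * a + 1) + ∑ a ∈ range n, f (2 * a + 2)) := by
  induction n with
  | zero => simp [sum_range_succ]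
  | succ n ih =>
    rw [show 2 * (n + 1) + 2 = 2 * n + 2 + 1 + 1 by ring, sum_range_succ, sum_range_succ, ih,
      sum_range_succ, sum_range_succ]
    rw [show 2 * (n + 1) + 1 = 2 * n + 2 + 1 by ring]
    abel

lemma sum_range_two_mul_add_three {M : Type*} [AddCommMonoid M] (f : ℕ → M) (n : ℕ) :
    ∑ m ∈ range (2 * n + 3), f m =
      f 0 + f (2 * n + 2) +
        (∑ a ∈ range (n + 1), f (2 * a + 1) + ∑ a ∈ range n, f (2 * a + 2)) := by
  rw [sum_range_succ, sum_range_two_mul_add_two, sum_range_succ]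
  abel

/-- The generating function for words of even length `2 * n + 2`, with the factor `1 + p` of the
last odd position removed. -/
def reducedEvenSum (n : ℕ) (p q : ℚ) : ℚ := oddEvenSum (2 * n + 2) p q / (1 + p)

lemma oddEvenSum_two_mul_add_two (n : ℕ) {p : ℚ} (q : ℚ) (hp : 0 ≤ p) :
    oddEvenSum (2 * n + 2) p q = (1 + p) * reducedEvenSum n p q := by
  have : 1 + p ≠ 0 := by positivity
  rw [reducedEvenSum, mul_div_cancel₀ _ this]

lemma oddEvenSum_zero (p q : ℚ) : oddEvenSum 0 p q = 1 := by
  simp [oddEvenSum, odes, edes]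

/-- The extreme terms m = 0 and m = 2n + 2 contribute p(1 + q) and 1 + p, which add up to 1 + 2p +
pq. An even middle term carries (1 + p)(1 + q) = 1 + pq + (p + q). The outer factors `q` and `p` are
not symmetric; averaging later repairs this. -/
lemma oddEvenSum_two_mul_add_three (n : ℕ) (h : ∀ a ≤ n, IsHomogSymm a (reducedEvenSum a))
    {p q : ℚ} (hp : 0 ≤ p) (hq : 0 ≤ q) :
    oddEvenSum (2 * n + 3) p q = (1 + 2 * p + p * q) * reducedEvenSum n p q +
      (q * ∑ a ∈ range (n + 1), ((2 * n + 2).choose (2 * a + 1) : ℚ) *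
          (oddEvenSum (2 * a + 1) p q * oddEvenSum (2 * (n - a) + 1) p q) +
        p * ((1 + p * q + (p + q)) * ∑ a ∈ range n, ((2 * n + 2).choose (2 * a + 2) : ℚ) *
          (reducedEvenSum a p q * reducedEvenSum (n - 1 - a) p q))) := by
  have hs : ∀ a ≤ n, reducedEvenSum a q p = reducedEvenSum a p q := fun a ha =>
    (h a ha).symm hq hp
  rw [oddEvenSum_succ, sum_range_two_mul_add_three]
  congr 1
  · simp [oddEvenSum_zero, oddEvenSum_two_mul_add_two n q hp, oddEvenSum_two_mul_add_two n p hq, hs]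
    ring
  · simp only [mul_sum]
    congr 1
    · refine sum_congr rfl fun a ha => ?_
      rw [mem_range] at ha
      have h1 : ¬ Even (2 * a + 1) := by simp
      have h2 : 2 * n + 2 - (2 * a + 1) = 2 * (n - a) + 1 := by omega
      have h3 : 2 * a + 1 ≠ 2 * n + 2 := by omega
      rw [if_neg h1, h2, if_neg h3]
      ring
    · refine sum_congr rfl fun a ha => ?_
      rw [mem_range] at ha
      have h1 : Even (2 * a + 2) := ⟨a + 1, by ring⟩
      have h2 : 2 * n + 2 - (2 * a + 2) = 2 * (n - 1 - a) + 2 := by omega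
      have h3 : 2 * a + 2 ≠ 2 * n + 2 := by omega
      rw [if_pos h1, h2, if_neg h3, oddEvenSum_two_mul_add_two _ q hp,
        oddEvenSum_two_mul_add_two _ p hq, hs _ (by omega)]
      ring

/-- Every term of the recursion contains 1 + p, and the odd and even cuts give the same sum, with
factors `q` and `p`, which combine to p + q. -/
lemma reducedEvenSum_eq (n : ℕ) {p : ℚ} (q : ℚ) (hp : 0 ≤ p) :
    reducedEvenSum n p q = oddEvenSum (2 * n + 1) p q +
      (p + q) * ∑ a ∈ range n, ((2 * n + 1).choose (2 * a + 1) : ℚ) *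
        (oddEvenSum (2 * a + 1) p q * reducedEvenSum (n - 1 - a) p q) := by
  have h0 : 1 + p ≠ 0 := by positivity
  have : oddEvenSum (2 * n + 2) p q = (1 + p) * oddEvenSum (2 * n + 1) p q +
      ((1 + p) * q * ∑ a ∈ range n, ((2 * n + 1).choose (2 * a + 1) : ℚ) *
        (oddEvenSum (2 * a + 1) p q * reducedEvenSum (n - 1 - a) p q) +
      (1 + p) * p * ∑ a ∈ range n, ((2 * n + 1).choose (2 * a + 1) : ℚ) *
        (oddEvenSum (2 * a + 1) p q * reducedEvenSum (n - 1 - a) p q)) := by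
    rw [oddEvenSum_succ, sum_range_two_mul_add_two]
    congr 1
    · simp [oddEvenSum_zero, oddEvenSum_symm_of_odd n q p]
      ring
    -- Reflecting a to n - 1 - a matches the cuts of even index with those of odd index.
    · rw [← sum_range_reflect (fun a => ((2 * n + 1).choose (2 * a + 2) : ℚ) * _)]
      simp only [mul_sum]
      congr 1
      · refine sum_congr rfl fun a ha => ?_
        rw [mem_range] at ha
        have h1 : ¬ Even (2 * a + 1) := by simp
        have h2 : 2 * n + 1 - (2 * a + 1) = 2 * (n - 1 - a) + 2 := by omega
        have h3 : 2 * a + 1 ≠ 2 * n + 1 := by omega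
        rw [if_neg h1, h2, if_neg h3, oddEvenSum_two_mul_add_two _ q hp]
        ring
      · refine sum_congr rfl fun a ha => ?_
        rw [mem_range] at ha
        have h1 : Even (2 * (n - 1 - a) + 2) := ⟨n - 1 - a + 1, by ring⟩
        have h2 : 2 * n + 1 - (2 * (n - 1 - a) + 2) = 2 * a + 1 := by omega
        have h3 : 2 * (n - 1 - a) + 2 ≠ 2 * n + 1 := by omega
        have h4 : (2 * n + 1).choose (2 * (n - 1 - a) + 2) = (2 * n + 1).choose (2 * a + 1) := by
          rw [← h2, Nat.choose_symm (by omega)]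
        rw [if_pos h1, h2, if_neg h3, h4, oddEvenSum_two_mul_add_two _ q hp,
          oddEvenSum_symm_of_odd a q p]
        ring
  rw [reducedEvenSum, this]
  field_simp
  ring

/-- Since F_{2n+3} is symmetric, it equals the average of its recursion and the swapped one.
Averaging turns 1 + 2p + pq into 1 + pq + (p + q), and the lone factors `p` and `q` into (p + q) /
2. -/
lemma isHomogSymm_oddEvenSum_and_reducedEvenSum (n : ℕ) :
    IsHomogSymm n (oddEvenSum (2 * n + 1)) ∧ IsHomogSymm n (reducedEvenSum n) := by
  induction n using Nat.strong_induction_on with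
  | _ n ih =>
    have hodd : IsHomogSymm n (oddEvenSum (2 * n + 1)) := by
      cases n with
      | zero =>
        refine (IsHomogSymm.const 1).congr fun p q _ _ => ?_
        rw [oddEvenSum_succ]
        simp [oddEvenSum_zero]
      | succ n =>
        have hQ : ∀ a ≤ n, IsHomogSymm a (reducedEvenSum a) := fun a ha => (ih a (by omega)).2
        have hPP : IsHomogSymm n fun p q =>
            ∑ a ∈ range (n + 1), ((2 * n + 2).choose (2 * a + 1) : ℚ) *
              (oddEvenSum (2 * a + 1) p q * oddEvenSum (2 * (n - a) + 1) p q) := by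
          refine IsHomogSymm.sum _ fun a ha => IsHomogSymm.const_mul _ ?_
          rw [mem_range] at ha
          have := (ih a (by omega)).1.mul (ih (n - a) (by omega)).1
          rwa [show a + (n - a) = n by omega] at this
        have hQQ : IsHomogSymm n fun p q => (1 + p * q + (p + q)) *
            ∑ a ∈ range n, ((2 * n + 2).choose (2 * a + 2) : ℚ) *
              (reducedEvenSum a p q * reducedEvenSum (n - 1 - a) p q) := by
          -- For `n = 0` the sum is empty, which compensates for the degree-one factor in front.
          cases n with
          | zero => exact (IsHomogSymm.const 0).congr (by simp)
          | succ n =>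
            rw [add_comm n 1]
            refine (IsHomogSymm.one_add_mul.add IsHomogSymm.add_self).mul
              (IsHomogSymm.sum _ fun a ha => IsHomogSymm.const_mul _ ?_)
            rw [mem_range] at ha
            have := (ih a (by omega)).2.mul (ih (n - a) (by omega)).2
            rw [show a + (n - a) = n by omega] at this
            rwa [show 1 + n - 1 - a = n - a by omega]
        rw [add_comm n 1]
        refine (((IsHomogSymm.one_add_mul.add IsHomogSymm.add_self).mul (hQ n le_rfl)).add
          ((IsHomogSymm.add_self.mul (hPP.add hQQ)).const_mul (1 / 2))).congr fun p q hp hq => ?_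
        have e1 := oddEvenSum_two_mul_add_three n hQ hp hq
        have e2 := oddEvenSum_two_mul_add_three n hQ hq hp
        rw [hPP.symm hq hp, (hQ n le_rfl).symm hq hp, hQQ.symm hq hp] at e2
        have e3 := oddEvenSum_symm_of_odd (n + 1) p q
        rw [show 2 * (1 + n) + 1 = 2 * n + 3 by ring]
        rw [show 2 * (n + 1) + 1 = 2 * n + 3 by ring] at e3
        linear_combination (1 / 2) * e1 + (1 / 2) * e2 + (1 / 2) * e3
    refine ⟨hodd, ?_⟩
    have hPQ : IsHomogSymm n fun p q => (p + q) *
        ∑ a ∈ range n, ((2 * n + 1).choose (2 * a + 1) : ℚ) *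
          (oddEvenSum (2 * a + 1) p q * reducedEvenSum (n - 1 - a) p q) := by
      cases n with
      | zero => exact (IsHomogSymm.const 0).congr (by simp)
      | succ n =>
        rw [add_comm n 1]
        refine IsHomogSymm.add_self.mul
          (IsHomogSymm.sum _ fun a ha => IsHomogSymm.const_mul _ ?_)
        rw [mem_range] at ha
        have := (ih a (by omega)).1.mul (ih (n - a) (by omega)).2
        rw [show a + (n - a) = n by omega] at this
        rwa [show 1 + n - 1 - a = n - a by omega]
    exact (hodd.add hPQ).congr fun p q hp _ => reducedEvenSum_eq n q hp

end EulerianDescents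

/-! ### Specializations of the generating function and their coefficients. -/

namespace EulerianDescents

open Finset Polynomial

lemma des_eq_odes_add_edes {N : ℕ} (σ : Equiv.Perm (Fin N)) : des σ = odes σ + edes σ := by
  rw [des, odes, edes, ← card_union_of_disjoint, ← filter_or]
  · congr 1
    refine filter_congr fun i _ => ?_
    have := Nat.even_or_odd i
    tauto
  · rw [disjoint_filter]
    rintro i _ ⟨_, h⟩ ⟨_, h'⟩
    exact Nat.not_even_iff_odd.2 h h'

lemma des_le {N : ℕ} (σ : Equiv.Perm (Fin N)) : des σ ≤ N :=
  (card_filter_le _ _).trans (card_range N).le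

/-- The generating polynomial of the numbers `eulerian N k`. -/
noncomputable def eulerianPoly (N : ℕ) : ℚ[X] := ∑ k ∈ range (N + 1), C (eulerian N k : ℚ) * X ^ k

/-- The generating polynomial of the numbers `evenDescentCount N k`. -/
noncomputable def evenDescentPoly (N : ℕ) : ℚ[X] :=
  ∑ k ∈ range (N + 1), C (evenDescentCount N k : ℚ) * X ^ k

lemma coeff_eulerianPoly {N k : ℕ} (hk : k ≤ N) : (eulerianPoly N).coeff k = eulerian N k := by
  simp [eulerianPoly, coeff_X_pow, hk]

lemma coeff_evenDescentPoly {N k : ℕ} (hk : k ≤ N) :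
    (evenDescentPoly N).coeff k = evenDescentCount N k := by
  simp [evenDescentPoly, coeff_X_pow, hk]

lemma eval_eulerianPoly (N : ℕ) (t : ℚ) : (eulerianPoly N).eval t = oddEvenSum N t t := by
  rw [eulerianPoly, oddEvenSum, ← sum_fiberwise_of_maps_to (s := univ) (g := des)
    (t := range (N + 1)) (fun σ _ => mem_range.2 (Nat.lt_succ_of_le (des_le σ))), eval_finsetSum]
  refine sum_congr rfl fun k _ => ?_
  rw [sum_congr rfl (g := fun _ => t ^ k), sum_const, nsmul_eq_mul]
  · simp [eulerian]
  · intro σ hσ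
    rw [← pow_add, ← des_eq_odes_add_edes, (mem_filter.1 hσ).2]

lemma eval_evenDescentPoly (N : ℕ) (t : ℚ) :
    (evenDescentPoly N).eval t = oddEvenSum N 0 t := by
  rw [evenDescentPoly, oddEvenSum, ← sum_fiberwise_of_maps_to (s := univ) (g := edes)
    (t := range (N + 1)) (fun σ _ => mem_range.2 (Nat.lt_succ_of_le
      (le_trans (by rw [des_eq_odes_add_edes]; omega) (des_le σ)))), eval_finsetSum]
  refine sum_congr rfl fun k _ => ?_
  rw [sum_congr rfl (g := fun σ => if odes σ = 0 then t ^ k else 0), ← sum_filter, sum_const,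
    nsmul_eq_mul, filter_filter]
  · simp [evenDescentCount]
  · intro σ hσ
    rw [(mem_filter.1 hσ).2]
    split_ifs with h <;> simp [h]

lemma eq_of_eval_eq_of_nonneg {f g : ℚ[X]} (h : ∀ t : ℚ, 0 ≤ t → f.eval t = g.eval t) : f = g :=
  eq_of_infinite_eval_eq f g ((Set.Ici_infinite (0 : ℚ)).mono fun t ht => h t ht)

/-- Setting p = 0 identifies `e` with the dehomogenization; setting p = q = t then evaluates it at
2t / (1 + t^2), and the degree bound lets the power (1 + t^2)^n clear all denominators. -/
lemma IsHomogSymm.eval_diag {n : ℕ} {f : ℚ → ℚ → ℚ} (hf : IsHomogSymm n f) {e : ℚ[X]}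
    (he : ∀ t, 0 ≤ t → e.eval t = f 0 t) {t : ℚ} (ht : 0 ≤ t) :
    f t t = (∑ j ∈ range (n + 1), C (2 ^ j * e.coeff j) * (X ^ j * (1 + X ^ 2) ^ (n - j))).eval t := by
  obtain ⟨g, hg, hg'⟩ := hf
  obtain rfl : e = g := eq_of_eval_eq_of_nonneg fun t ht => by
    rw [he t ht, hg' 0 t le_rfl ht]; simp
  rw [hg' t t ht ht, eval_eq_sum_range' (Nat.lt_succ_of_le hg), mul_sum, eval_finsetSum]
  refine sum_congr rfl fun j hj => ?_
  obtain ⟨i, rfl⟩ := Nat.exists_eq_add_of_le (Nat.lt_succ_iff.1 (mem_range.1 hj))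
  have : 1 + t * t ≠ 0 := by positivity
  simp only [eval_mul, eval_C, eval_pow, eval_X, eval_add, eval_one, Nat.add_sub_cancel_left]
  rw [pow_add, div_pow, ← sq]
  field_simp
  ring

lemma eulerianPoly_odd (n : ℕ) :
    eulerianPoly (2 * n + 1) = ∑ j ∈ range (n + 1),
      C (2 ^ j * (evenDescentCount (2 * n + 1) j : ℚ)) * (X ^ j * (1 + X ^ 2) ^ (n - j)) := by
  refine eq_of_eval_eq_of_nonneg fun t ht => ?_
  rw [eval_eulerianPoly, (isHomogSymm_oddEvenSum_and_reducedEvenSum n).1.eval_diag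
    (fun t _ => eval_evenDescentPoly _ t) ht]
  congr 1
  refine sum_congr rfl fun j hj => ?_
  rw [mem_range] at hj
  rw [coeff_evenDescentPoly (by omega)]

lemma eulerianPoly_even (n : ℕ) :
    eulerianPoly (2 * n + 2) = (1 + X) * ∑ j ∈ range (n + 1),
      C (2 ^ j * (evenDescentCount (2 * n + 2) j : ℚ)) * (X ^ j * (1 + X ^ 2) ^ (n - j)) := by
  refine eq_of_eval_eq_of_nonneg fun t ht => ?_
  rw [eval_eulerianPoly, oddEvenSum_two_mul_add_two n t ht, eval_mul,
    (isHomogSymm_oddEvenSum_and_reducedEvenSum n).2.eval_diag (e := evenDescentPoly (2 * n + 2))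
    (fun t _ => by simp [eval_evenDescentPoly, reducedEvenSum]) ht, eval_add, eval_one, eval_X]
  congr 2
  refine sum_congr rfl fun j hj => ?_
  rw [mem_range] at hj
  rw [coeff_evenDescentPoly (by omega)]

lemma coeff_X_pow_mul_one_add_sq_pow (j m k : ℕ) :
    (X ^ j * (1 + X ^ 2) ^ m : ℚ[X]).coeff k =
      ∑ i ∈ range (m + 1), if j + 2 * i = k then (m.choose i : ℚ) else 0 := by
  rw [add_comm, add_pow, mul_sum, finsetSum_coeff]
  refine sum_congr rfl fun i _ => ?_
  rw [one_pow, mul_one, ← pow_mul, ← mul_assoc, ← pow_add, coeff_mul_natCast, coeff_X_pow]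
  simp [eq_comm]

lemma coeff_sum_X_pow_mul_one_add_sq_pow (b : ℕ → ℚ) {n k : ℕ} (hk : k ≤ n) :
    (∑ j ∈ range (n + 1), C (b j) * (X ^ j * (1 + X ^ 2) ^ (n - j))).coeff k =
      ∑ i ∈ range (k / 2 + 1), ((n - k + 2 * i).choose i : ℚ) * b (k - 2 * i) := by
  simp only [finsetSum_coeff, coeff_C_mul, coeff_X_pow_mul_one_add_sq_pow, mul_sum, mul_ite,
    mul_zero]
  rw [sum_sigma', ← sum_filter]
  symm
  refine sum_nbij' (fun i => ⟨k - 2 * i, i⟩) (fun x => x.2) ?_ ?_ ?_ ?_ ?_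
  · intro i hi
    simp only [mem_filter, mem_sigma, mem_range] at hi ⊢
    omega
  · rintro ⟨j, i⟩ hx
    simp only [mem_filter, mem_sigma, mem_range] at hx ⊢
    omega
  · intro i _; rfl
  · rintro ⟨j, i⟩ hx
    simp only [mem_filter, mem_sigma, mem_range] at hx
    obtain ⟨_, rfl⟩ := hx
    simp
  · intro i hi
    rw [mem_range] at hi
    rw [show n - (k - 2 * i) = n - k + 2 * i by omega, mul_comm]

end EulerianDescents

/-! ### Binomial inversion and the explicit formulas. -/

namespace EulerianDescents

open Finset

lemma invCoeff_zero_right (m : ℕ) : invCoeff m 0 = 1 := by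
  rcases Nat.eq_zero_or_pos m with rfl | h
  · simp [invCoeff]
  · have : (m : ℚ) ≠ 0 := by positivity
    simp [invCoeff, h.ne', this]

/-- Write the quotient as 1 + (i + 1) / (m + i + 1) and absorb the second fraction into the
binomial. -/
lemma invCoeff_succ (m i : ℕ) :
    invCoeff m (i + 1) = (m + (i + 1)).choose (i + 1) + (m + i).choose i := by
  have h : ((m + i + 1 : ℕ) : ℚ) * (m + i).choose i = (m + i + 1).choose (i + 1) * (i + 1 : ℕ) := by
    exact_mod_cast Nat.add_one_mul_choose_eq (m + i) i
  have h0 : (m : ℚ) + (i + 1) ≠ 0 := by positivity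
  push_cast at h
  rw [invCoeff, if_neg (by omega), ← add_assoc]
  push_cast
  field_simp
  linear_combination -h

lemma invCoeff_zero_left_succ (i : ℕ) : invCoeff 0 (i + 1) = 2 := by
  rw [invCoeff_succ]; norm_num

section PowerSeries

open PowerSeries

lemma mk_neg_one_pow_mul_choose_mul_one_add_X_pow (m : ℕ) :
    (PowerSeries.mk fun i => (-1 : ℚ) ^ i * ((m + i).choose i : ℚ)) * (1 + X) ^ (m + 1) = 1 := by
  have h := congrArg (rescale (-1 : ℚ)) (mk_add_choose_mul_one_sub_pow_eq_one ℚ m)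
  rw [map_mul, map_pow, map_sub, map_one, rescale_neg_one_X, sub_neg_eq_add] at h
  convert h using 2
  ext i
  rw [coeff_rescale, coeff_mk, coeff_mk, Nat.choose_symm_add]

lemma mk_invCoeff_mul_one_add_X_pow (m : ℕ) :
    (PowerSeries.mk fun i => (-1 : ℚ) ^ i * invCoeff m i) * (1 + X) ^ (m + 1) = 1 - X := by
  have : (PowerSeries.mk fun i => (-1 : ℚ) ^ i * invCoeff m i) =
      (1 - X) * PowerSeries.mk fun i => (-1 : ℚ) ^ i * ((m + i).choose i : ℚ) := by
    ext i
    cases i with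
    | zero => simp [sub_mul, invCoeff_zero_right]
    | succ i =>
      rw [sub_mul, one_mul, map_sub, coeff_succ_X_mul, coeff_mk, coeff_mk, coeff_mk, invCoeff_succ]
      ring
  rw [this, mul_assoc, mk_neg_one_pow_mul_choose_mul_one_add_X_pow, mul_one]

lemma coeff_one_add_X_pow (N k : ℕ) : coeff k ((1 + X : ℚ⟦X⟧) ^ N) = N.choose k := by
  have : ((1 + X : ℚ⟦X⟧) ^ N) = (((1 + Polynomial.X) ^ N : Polynomial ℚ) : ℚ⟦X⟧) := by simp
  rw [this, Polynomial.coeff_coe, Polynomial.coeff_one_add_X_pow]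

/-- Orthogonality relation behind the inversion. For s > 0 the sum is the coefficient of X^s in (1 -
X)(1 + X)^(2s-1), a difference of the two equal central binomials. -/
lemma sum_invCoeff_mul_choose (m s : ℕ) :
    ∑ i ∈ range (s + 1), (-1 : ℚ) ^ i * invCoeff m i * ((m + 2 * s).choose (s - i) : ℚ) =
      if s = 0 then 1 else 0 := by
  cases s with
  | zero => simp [invCoeff_zero_right]
  | succ s =>
    have h : coeff (s + 1) ((PowerSeries.mk fun i => (-1 : ℚ) ^ i * invCoeff m i) *
        (1 + X) ^ (m + 2 * (s + 1))) = 0 := by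
      rw [show m + 2 * (s + 1) = m + 1 + (2 * s + 1) by ring, pow_add, ← mul_assoc,
        mk_invCoeff_mul_one_add_X_pow, sub_mul, one_mul, map_sub, coeff_succ_X_mul,
        coeff_one_add_X_pow, coeff_one_add_X_pow, Nat.choose_symm_half, sub_self]
    rw [coeff_mul, Nat.sum_antidiagonal_eq_sum_range_succ_mk] at h
    simpa [coeff_one_add_X_pow] using h

end PowerSeries

/-- After substituting `hD` and grouping by the total shift s = i + j, the inner sum vanishes by
orthogonality unless s = 0. -/
lemma eq_sum_invCoeff_mul {n : ℕ} {b D : ℕ → ℚ}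
    (hD : ∀ k ≤ n, D k = ∑ i ∈ range (k / 2 + 1), ((n - k + 2 * i).choose i : ℚ) * b (k - 2 * i))
    {k : ℕ} (hk : k ≤ n) :
    b k = ∑ i ∈ range (k / 2 + 1), (-1 : ℚ) ^ i * invCoeff (n - k) i * D (k - 2 * i) := by
  have h1 : ∑ i ∈ range (k / 2 + 1), (-1 : ℚ) ^ i * invCoeff (n - k) i * D (k - 2 * i) =
      ∑ s ∈ range (k / 2 + 1), ∑ i ∈ range (s + 1),
        (-1 : ℚ) ^ i * invCoeff (n - k) i * ((n - k + 2 * s).choose (s - i) : ℚ) *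
          b (k - 2 * s) := by
    rw [sum_congr rfl fun i _ => by rw [hD (k - 2 * i) (by omega), mul_sum], sum_sigma',
      sum_sigma']
    refine sum_nbij' (fun x => ⟨x.1 + x.2, x.1⟩) (fun x => ⟨x.2, x.1 - x.2⟩) ?_ ?_ ?_ ?_ ?_
    · rintro ⟨i, j⟩ h
      simp only [mem_sigma, mem_range] at h ⊢
      omega
    · rintro ⟨s, i⟩ h
      simp only [mem_sigma, mem_range] at h ⊢
      omega
    · rintro ⟨i, j⟩ _
      simp
    · rintro ⟨s, i⟩ h
      simp only [mem_sigma, mem_range] at h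
      have : i + (s - i) = s := by omega
      simp [this]
    · rintro ⟨i, j⟩ h
      simp only [mem_sigma, mem_range] at h
      simp only [Nat.add_sub_cancel_left]
      rw [show n - (k - 2 * i) + 2 * j = n - k + 2 * (i + j) by omega,
        show k - 2 * i - 2 * j = k - 2 * (i + j) by omega]
      ring
  rw [h1]
  simp only [← sum_mul, sum_invCoeff_mul_choose]
  simp

/-- The alternating sum `∑ (-1) ^ (k - j) * A_{N,j}` of the Eulerian numbers up to `k`. -/
def alternatingEulerian (N k : ℕ) : ℚ :=
  ∑ j ∈ range (k + 1), (-1 : ℚ) ^ (k - j) * (eulerian N j : ℚ)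

lemma alternatingEulerian_succ (N k : ℕ) :
    alternatingEulerian N (k + 1) = eulerian N (k + 1) - alternatingEulerian N k := by
  rw [alternatingEulerian, sum_range_succ, Nat.sub_self, pow_zero, one_mul, alternatingEulerian,
    add_comm, sub_eq_add_neg, ← sum_neg_distrib]
  congr 1
  refine sum_congr rfl fun j hj => ?_
  rw [mem_range] at hj
  rw [show k + 1 - j = k - j + 1 by omega, pow_succ]
  ring

lemma eulerian_odd_eq_sum {n k : ℕ} (hk : k ≤ n) :
    (eulerian (2 * n + 1) k : ℚ) = ∑ i ∈ range (k / 2 + 1), ((n - k + 2 * i).choose i : ℚ) *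
      (2 ^ (k - 2 * i) * (evenDescentCount (2 * n + 1) (k - 2 * i) : ℚ)) := by
  rw [← coeff_eulerianPoly (by omega), eulerianPoly_odd,
    coeff_sum_X_pow_mul_one_add_sq_pow (fun j => 2 ^ j * (evenDescentCount (2 * n + 1) j : ℚ)) hk]

/-- The alternating sums are the coefficients of the Eulerian polynomial divided by 1 + X, which is
the factor removed in `eulerianPoly_even`. -/
lemma alternatingEulerian_eq_sum {n k : ℕ} (hk : k ≤ n) :
    alternatingEulerian (2 * n + 2) k =
      ∑ i ∈ range (k / 2 + 1), ((n - k + 2 * i).choose i : ℚ) *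
        (2 ^ (k - 2 * i) * (evenDescentCount (2 * n + 2) (k - 2 * i) : ℚ)) := by
  rw [← coeff_sum_X_pow_mul_one_add_sq_pow
    (fun j => 2 ^ j * (evenDescentCount (2 * n + 2) j : ℚ)) hk]
  induction k with
  | zero =>
    have h := coeff_eulerianPoly (N := 2 * n + 2) (k := 0) (by omega)
    rw [eulerianPoly_even, Polynomial.mul_coeff_zero] at h
    simp only [Polynomial.coeff_add, Polynomial.coeff_one_zero, Polynomial.coeff_X_zero, add_zero,
      one_mul] at h
    rw [h]
    simp [alternatingEulerian]
  | succ k ih =>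
    have h := coeff_eulerianPoly (N := 2 * n + 2) (k := k + 1) (by omega)
    rw [eulerianPoly_even, add_mul, one_mul, Polynomial.coeff_add, Polynomial.coeff_X_mul] at h
    rw [alternatingEulerian_succ, ih (by omega), ← h]
    ring

lemma evenDescentCount_odd_eq_sum {n k : ℕ} (hk : k ≤ n) :
    (evenDescentCount (2 * n + 1) k : ℚ) = 1 / 2 ^ k * ∑ i ∈ range (k / 2 + 1),
      (-1 : ℚ) ^ i * invCoeff (n - k) i * (eulerian (2 * n + 1) (k - 2 * i) : ℚ) := by
  rw [← eq_sum_invCoeff_mul (D := fun k => (eulerian (2 * n + 1) k : ℚ))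
    (b := fun j => 2 ^ j * (evenDescentCount (2 * n + 1) j : ℚ))
    (fun k hk => eulerian_odd_eq_sum hk) hk]
  field_simp

lemma evenDescentCount_even_eq_sum {n k : ℕ} (hk : k ≤ n) :
    (evenDescentCount (2 * n + 2) k : ℚ) = 1 / 2 ^ k * ∑ i ∈ range (k / 2 + 1),
      (-1 : ℚ) ^ i * invCoeff (n - k) i * alternatingEulerian (2 * n + 2) (k - 2 * i) := by
  rw [← eq_sum_invCoeff_mul (D := alternatingEulerian (2 * n + 2))
    (b := fun j => 2 ^ j * (evenDescentCount (2 * n + 2) j : ℚ))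
    (fun k hk => alternatingEulerian_eq_sum hk) hk]
  field_simp

/-- In the case k = n the coefficients are 1, 2, 2, ..., which explains the shape of the Euler
number formulas. -/
lemma sum_invCoeff_zero_left (K : ℕ) (f : ℕ → ℚ) :
    ∑ i ∈ range (K + 1), (-1 : ℚ) ^ i * invCoeff 0 i * f i =
      -f 0 + 2 * ∑ i ∈ range (K + 1), (-1 : ℚ) ^ i * f i := by
  rw [sum_range_succ', sum_range_succ', invCoeff_zero_right, mul_add, mul_sum]
  simp only [invCoeff_zero_left_succ]
  rw [sum_congr rfl fun i _ => show (-1 : ℚ) ^ (i + 1) * 2 * f (i + 1) =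
    2 * ((-1 : ℚ) ^ (i + 1) * f (i + 1)) by ring]
  ring

lemma sum_filter_two_mul_add_eq {M : Type*} [AddCommMonoid M] {k m : ℕ} (hk : k < m)
    (f : ℕ → ℕ → M) :
    ∑ x ∈ (range m ×ˢ range m).filter (fun x => 2 * x.1 + x.2 = k), f x.1 x.2 =
      ∑ i ∈ range (k / 2 + 1), f i (k - 2 * i) := by
  refine sum_nbij' (fun x => x.1) (fun i => (i, k - 2 * i)) ?_ ?_ ?_ ?_ ?_
  · rintro ⟨i, j⟩ h
    simp only [mem_filter, mem_product, mem_range] at h ⊢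
    omega
  · intro i h
    simp only [mem_filter, mem_product, mem_range] at h ⊢
    omega
  · rintro ⟨i, j⟩ h
    simp only [mem_filter, mem_product, mem_range] at h
    simp only [Prod.mk.injEq, true_and]
    omega
  · intro i _; rfl
  · rintro ⟨i, j⟩ h
    simp only [mem_filter, mem_product, mem_range] at h
    rw [show k - 2 * i = j by omega]

lemma sum_filter_two_mul_add_le {M : Type*} [AddCommMonoid M] (k : ℕ) (f : ℕ → ℕ → M) :
    ∑ x ∈ (range (k + 1) ×ˢ range (k + 1)).filter (fun x => 2 * x.1 + x.2 ≤ k), f x.1 x.2 =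
      ∑ i ∈ range (k / 2 + 1), ∑ j ∈ range (k - 2 * i + 1), f i j := by
  rw [sum_sigma']
  refine sum_nbij' (fun x => ⟨x.1, x.2⟩) (fun x => (x.1, x.2)) ?_ ?_ ?_ ?_ ?_
  · rintro ⟨i, j⟩ h
    simp only [mem_filter, mem_product, mem_sigma, mem_range] at h ⊢
    omega
  · rintro ⟨i, j⟩ h
    simp only [mem_filter, mem_product, mem_sigma, mem_range] at h ⊢
    omega
  all_goals intros; rfl

lemma sum_filter_two_mul_add_add_eq {M : Type*} [AddCommMonoid M] (k : ℕ) (f : ℕ → ℕ → ℕ → M) :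
    ∑ x ∈ (range (k + 1) ×ˢ range (k + 1) ×ˢ range (k + 1)).filter
        (fun x => 2 * x.1 + x.2.1 + x.2.2 = k), f x.1 x.2.1 x.2.2 =
      ∑ i ∈ range (k / 2 + 1), ∑ j ∈ range (k - 2 * i + 1), f i j (k - 2 * i - j) := by
  rw [sum_sigma']
  refine sum_nbij' (fun x => ⟨x.1, x.2.1⟩) (fun x => (x.1, x.2, k - 2 * x.1 - x.2)) ?_ ?_ ?_ ?_ ?_
  · rintro ⟨i, j, r⟩ h
    simp only [mem_filter, mem_product, mem_sigma, mem_range] at h ⊢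
    omega
  · rintro ⟨i, j⟩ h
    simp only [mem_filter, mem_product, mem_sigma, mem_range] at h ⊢
    omega
  · rintro ⟨i, j, r⟩ h
    simp only [mem_filter, mem_product, mem_range] at h
    simp only [Prod.mk.injEq, true_and]
    omega
  · rintro ⟨i, j⟩ _; rfl
  · rintro ⟨i, j, r⟩ h
    simp only [mem_filter, mem_product, mem_range] at h
    rw [show k - 2 * i - j = r by omega]

/-- An Eulerian number is the sum of two consecutive alternating sums; these are the two
alternatives in the filter. -/
lemma eulerian_even_eq_sum {n k : ℕ} (hk : k ≤ n) :
    (eulerian (2 * n + 2) k : ℚ) =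
      ∑ x ∈ (range (k + 1) ×ˢ range (k + 1)).filter
          (fun x => 2 * x.1 + x.2 = k ∨ 2 * x.1 + x.2 + 1 = k),
        ((n - x.2).choose x.1 : ℚ) * (2 ^ x.2 * (evenDescentCount (2 * n + 2) x.2 : ℚ)) := by
  -- The box size `m` is kept separate from `l` because both `l = k` and `l = k - 1` are summed over
  -- the same box.
  have key : ∀ l m, l ≤ n → l < m → ∑ x ∈ (range m ×ˢ range m).filter
      (fun x => 2 * x.1 + x.2 = l), ((n - x.2).choose x.1 : ℚ) *
        (2 ^ x.2 * (evenDescentCount (2 * n + 2) x.2 : ℚ)) = alternatingEulerian (2 * n + 2) l := by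
    intro l m hl hm
    rw [sum_filter_two_mul_add_eq hm (fun i j => ((n - j).choose i : ℚ) *
        (2 ^ j * (evenDescentCount (2 * n + 2) j : ℚ))), alternatingEulerian_eq_sum hl]
    refine sum_congr rfl fun i hi => ?_
    rw [mem_range] at hi
    rw [show n - (l - 2 * i) = n - l + 2 * i by omega]
  rw [filter_or, sum_union, key k _ hk (by omega)]
  · cases k with
    | zero => simp [alternatingEulerian]
    | succ k =>
      simp only [Nat.add_right_cancel_iff]
      rw [key k _ (by omega) (by omega), alternatingEulerian_succ, sub_add_cancel]
  · rw [disjoint_filter]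
    intro x _ h h'
    omega

/-! ### Euler numbers. -/

/-- There are exactly `(N - 1) / 2` even positions between 1 and `N - 1`, so reaching this count
forces a descent at each of them. -/
lemma edes_eq_and_odes_eq_zero_iff {N : ℕ} (σ : Equiv.Perm (Fin N)) :
    edes σ = (N - 1) / 2 ∧ odes σ = 0 ↔ ∀ i ∈ Ico 1 N, (IsDescent σ i ↔ Even i) := by
  have hcard : #{i ∈ range N | 1 ≤ i ∧ Even i} = (N - 1) / 2 := by
    rw [← card_range ((N - 1) / 2)]
    symm
    refine card_nbij' (fun i => 2 * i + 2) (fun i => i / 2 - 1) ?_ ?_ ?_ ?_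
    · intro i hi
      simp only [mem_coe, mem_range, mem_filter, Nat.even_iff] at hi ⊢
      omega
    · intro i hi
      simp only [mem_coe, mem_range, mem_filter, Nat.even_iff] at hi ⊢
      omega
    · intro i hi
      show (2 * i + 2) / 2 - 1 = i
      omega
    · intro i hi
      simp only [mem_coe, mem_range, mem_filter, Nat.even_iff] at hi
      show 2 * (i / 2 - 1) + 2 = i
      omega
  have hsub : {i ∈ range N | IsDescent σ i ∧ Even i} ⊆ {i ∈ range N | 1 ≤ i ∧ Even i} :=
    monotone_filter_right _ fun i _ h => ⟨h.1.1.1, h.2⟩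
  rw [odes, card_eq_zero, filter_eq_empty_iff, edes, ← hcard]
  constructor
  · rintro ⟨h1, h2⟩ i hi
    rw [mem_Ico] at hi
    refine ⟨fun h => ?_, fun h => ?_⟩
    · rw [← Nat.not_odd_iff_even]
      exact fun h' => h2 (mem_range.2 hi.2) ⟨h, h'⟩
    · have := eq_of_subset_of_card_le hsub h1.ge
      have hm : i ∈ {i ∈ range N | 1 ≤ i ∧ Even i} :=
        mem_filter.2 ⟨mem_range.2 hi.2, hi.1, h⟩
      rw [← this] at hm
      exact (mem_filter.1 hm).2.1
  · intro h
    refine ⟨?_, fun i hi ⟨h1, h2⟩ => ?_⟩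
    · congr 1
      refine subset_antisymm hsub fun i hi => ?_
      obtain ⟨h1, h2, h3⟩ := mem_filter.1 hi
      exact mem_filter.2 ⟨h1, (h i (mem_Ico.2 ⟨h2, mem_range.1 h1⟩)).2 h3, h3⟩
    · exact Nat.not_even_iff_odd.2 h2 ((h i (mem_Ico.2 ⟨h1.1.1, mem_range.1 hi⟩)).1 h1)

lemma isDescent_rev_mul {N : ℕ} (σ : Equiv.Perm (Fin N)) {i : ℕ} (hi : i ∈ Ico 1 N) :
    IsDescent (Fin.revPerm * σ) i ↔ ¬ IsDescent σ i := by
  rw [mem_Ico] at hi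
  simp only [IsDescent, Equiv.Perm.mul_apply, Fin.revPerm_apply, Fin.rev_lt_rev]
  have hne : σ ⟨i, hi.2⟩ ≠ σ ⟨i - 1, by omega⟩ := by
    rw [σ.injective.ne_iff, Ne, Fin.mk.injEq]; omega
  refine ⟨fun ⟨_, h⟩ ⟨_, h'⟩ => lt_asymm h h', fun h => ⟨hi, ?_⟩⟩
  exact lt_of_le_of_ne (not_lt.1 fun h' => h ⟨hi, h'⟩) hne.symm

/-- Complementing the values exchanges descents and ascents, so descents at the odd positions become
descents at the even ones. -/
lemma eulerNumber_eq_evenDescentCount (N : ℕ) :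
    eulerNumber N = evenDescentCount N ((N - 1) / 2) := by
  rw [eulerNumber, evenDescentCount]
  refine card_equiv (Equiv.mulLeft Fin.revPerm) fun σ => ?_
  simp only [mem_filter, mem_univ, true_and, Equiv.coe_mulLeft, edes_eq_and_odes_eq_zero_iff]
  refine forall₂_congr fun i hi => ?_
  rw [isDescent_rev_mul σ hi, ← Nat.not_odd_iff_even, not_iff_not]

end EulerianDescents

theorem corollary3p3 :
    (∀ n k : ℕ, k ≤ n →
      eulerian (2 * n + 1) k =
          ∑ i ∈ Finset.range (k / 2 + 1),
            (n - k + 2 * i).choose i * 2 ^ (k - 2 * i) * evenDescentCount (2 * n + 1) (k - 2 * i) ∧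
      eulerian (2 * n + 2) k =
          ∑ x ∈ (Finset.range (k + 1) ×ˢ Finset.range (k + 1)).filter
              (fun x => 2 * x.1 + x.2 = k ∨ 2 * x.1 + x.2 + 1 = k),
            (n - x.2).choose x.1 * 2 ^ x.2 * evenDescentCount (2 * n + 2) x.2 ∧
      (evenDescentCount (2 * n + 1) k : ℚ) =
          1 / 2 ^ k * ∑ i ∈ Finset.range (k / 2 + 1),
            (-1 : ℚ) ^ i * invCoeff (n - k) i * (eulerian (2 * n + 1) (k - 2 * i) : ℚ) ∧
      (evenDescentCount (2 * n + 2) k : ℚ) =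
          1 / 2 ^ k *
            ∑ x ∈ (Finset.range (k + 1) ×ˢ Finset.range (k + 1) ×ˢ Finset.range (k + 1)).filter
                (fun x => 2 * x.1 + x.2.1 + x.2.2 = k),
              (-1 : ℚ) ^ (x.2.2 + x.1) * invCoeff (n - k) x.1 *
                (eulerian (2 * n + 2) x.2.1 : ℚ)) ∧
    (∀ n : ℕ,
      eulerNumber (2 * n + 1) = evenDescentCount (2 * n + 1) n ∧
      (evenDescentCount (2 * n + 1) n : ℚ) =
          1 / 2 ^ n * (-(eulerian (2 * n + 1) n : ℚ) +
            2 * ∑ i ∈ Finset.range (n / 2 + 1),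
              (-1 : ℚ) ^ i * (eulerian (2 * n + 1) (n - 2 * i) : ℚ)) ∧
      eulerNumber (2 * n + 2) = evenDescentCount (2 * n + 2) n ∧
      (evenDescentCount (2 * n + 2) n : ℚ) =
          1 / 2 ^ n *
            (-(∑ j ∈ Finset.range (n + 1), (-1 : ℚ) ^ (n - j) * (eulerian (2 * n + 2) j : ℚ)) +
            2 * ∑ x ∈ (Finset.range (n + 1) ×ˢ Finset.range (n + 1)).filter
                (fun x => 2 * x.1 + x.2 ≤ n),
              (-1 : ℚ) ^ (n - x.1 - x.2) * (eulerian (2 * n + 2) x.2 : ℚ))) := by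
  refine ⟨fun n k hk => ⟨?_, ?_, evenDescentCount_odd_eq_sum hk, ?_⟩, fun n => ⟨?_, ?_, ?_, ?_⟩⟩
  · have h := eulerian_odd_eq_sum hk
    simp only [← mul_assoc] at h
    exact_mod_cast h
  · have h := eulerian_even_eq_sum hk
    simp only [← mul_assoc] at h
    exact_mod_cast h
  · rw [evenDescentCount_even_eq_sum hk, sum_filter_two_mul_add_add_eq k (fun i j r =>
      (-1 : ℚ) ^ (r + i) * invCoeff (n - k) i * (eulerian (2 * n + 2) j : ℚ))]
    congr 1
    refine Finset.sum_congr rfl fun i _ => ?_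
    rw [alternatingEulerian, Finset.mul_sum]
    refine Finset.sum_congr rfl fun j _ => ?_
    rw [pow_add]
    ring
  · rw [eulerNumber_eq_evenDescentCount]
    congr 1
    omega
  · rw [evenDescentCount_odd_eq_sum le_rfl, Nat.sub_self,
      sum_invCoeff_zero_left _ fun i => (eulerian (2 * n + 1) (n - 2 * i) : ℚ)]
    simp
  · rw [eulerNumber_eq_evenDescentCount]
    congr 1
    omega
  · rw [evenDescentCount_even_eq_sum le_rfl, Nat.sub_self,
      sum_invCoeff_zero_left _ fun i => alternatingEulerian (2 * n + 2) (n - 2 * i),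
      sum_filter_two_mul_add_le n (fun i j =>
        (-1 : ℚ) ^ (n - i - j) * (eulerian (2 * n + 2) j : ℚ))]
    congr 3
    refine Finset.sum_congr rfl fun i hi => ?_
    rw [Finset.mem_range] at hi
    rw [alternatingEulerian, Finset.mul_sum]
    refine Finset.sum_congr rfl fun j hj => ?_
    rw [Finset.mem_range] at hj
    -- The sign splits into (-1)^i from the inversion and the sign inside the alternating sum up to
    -- `n - 2 * i`.
    rw [show n - i - j = i + (n - 2 * i - j) by omega, pow_add, mul_assoc]
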